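/- **Setting (noise-limited Poisson network with Rayleigh fading).** Base stations (BSs) form a homogeneous Poisson point process $\Phi=\{x_k\}_{k}$ in $\mathbb{R}^2$ of intensity $\lambda>0$, fixed over time, and the typical user is at the origin $o$. Let $M\ge 1$ be the number of beams of each BS, $P>0$ the transmit power, $W>0$ the total noise power and $\Gamma_{cs}>0$ the detection threshold. The path loss over distance $r$ is $l(r)=C_L r^{\alpha_L}$ for $r<R_c$ and $l(r)=C_N r^{\alpha_N}$ for $r\ge R_c$, where $C_L,C_N,R_c>0$ and $l$ is non-decreasing on $[0,\infty)$. For each initial access cycle $n\ge 1$ and each BS $x_k$ there is a fading variable $F_k(n)$; all these variables are i.i.d. exponential with mean $1$, and independent of $\Phi$. Split the plane into the sectors $S_M(i)=\{x:\angle x\in[2\pi\frac{i-1}{M},2\pi\frac{i}{M})\}$, $1\le i\le M$. Sector $i$ is detected in cycle $n$ if it contains a BS and the BS $x_k$ of smallest path loss $l(\|x_k\|)$ in $\Phi\cap S_M(i)$ satisfies $$\frac{F_k(n)/l(\|x_k\|)}{W/(PM)}>\Gamma_{cs}$$ (interference is neglected). Let $L_{cs}(M,\lambda)=\inf\{n\ge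 1:\text{at least one sector is detected in cycle } n\}\in\mathbb{N}\cup\{\infty\}$ be the number of cycles needed for cell search to succeed. **Theorem.** Suppose $\alpha_N=2$. Then $$\mathbb{E}[L_{cs}(M,\lambda)]=\infty\quad\text{if}\quad \lambda M<\frac{\Gamma_{cs}C_N W}{P\pi},\qquad \mathbb{E}[L_{cs}(M,\lambda)]<\infty\quad\text{if}\quad \lambda M>\frac{\Gamma_{cs}C_N W}{P\pi}.$$ That is, the phase transition for $\mathbb{E}[L_{cs}(M,\lambda)]$ happens at $(\lambda^*,M^*)$ with $\lambda^*M^*=\frac{\Gamma_{cs}C_N W}{P\pi}$. -/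

import Mathlib

open MeasureTheory ProbabilityTheory
open scoped ENNReal NNReal

noncomputable section

namespace CellSearch

/-- The plane in which base stations (BSs) and users live. -/
abbrev Plane : Type := EuclideanSpace ℝ (Fin 2)

/-- The counting measure `∑ k, δ_{X k}` of an enumerated point configuration. -/
def countingMeasure (X : ℕ → Plane) : Measure Plane :=
  Measure.sum fun k => Measure.dirac (X k)

/-- The random points `X 0, X 1, …` form a Poisson point process with intensity measure `ν`:
the number of points in a measurable set `B` of finite intensity is Poisson distributed with
mean `ν B`, and the numbers of points in finitely many pairwise disjoint measurable sets are
independent. The enumeration of the points is arbitrary. -/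
structure IsPoissonPointProcess {Ω : Type*} [MeasurableSpace Ω]
    (X : ℕ → Ω → Plane) (ν : Measure Plane) (μ : Measure Ω) : Prop where
  measurable : ∀ k, Measurable (X k)
  hasLaw_count : ∀ B : Set Plane, MeasurableSet B → ν B ≠ ∞ →
    HasLaw (fun ω => countingMeasure (fun k => X k ω) B)
      ((poissonMeasure (ν B).toNNReal).map (fun n : ℕ => (n : ℝ≥0∞))) μ
  indep_count : ∀ (m : ℕ) (B : Fin m → Set Plane), (∀ j, MeasurableSet (B j)) →
    (Pairwise fun i j => Disjoint (B i) (B j)) →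
    iIndepFun (fun (j : Fin m) (ω : Ω) => countingMeasure (fun k => X k ω) (B j)) μ

/-- A Poisson network with Rayleigh fading. The BS locations `X k` form a homogeneous Poisson
point process of intensity `lam` on the plane. `F n k` is the fading between BS `k` and the
typical user in initial access cycle `n`; these variables are i.i.d. (over BSs and cycles)
exponential with unit mean, and independent of the BS locations. The BS locations do not change
from cycle to cycle. -/
structure IsRayleighPoissonNetwork {Ω : Type*} [MeasurableSpace Ω]
    (X : ℕ → Ω → Plane) (F : ℕ → ℕ → Ω → ℝ) (lam : ℝ) (μ : Measure Ω) : Prop where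
  poisson : IsPoissonPointProcess X (ENNReal.ofReal lam • volume) μ
  fading_measurable : ∀ n k, Measurable (F n k)
  fading_law : ∀ n k, HasLaw (F n k) (expMeasure 1) μ
  fading_indep : iIndepFun (fun (p : ℕ × ℕ) => F p.1 p.2) μ
  indep : IndepFun (fun ω k => X k ω) (fun ω (p : ℕ × ℕ) => F p.1 p.2 ω) μ

/-- The dual-slope path loss function. -/
def pathLoss (C_L C_N α_L α_N R_c r : ℝ) : ℝ :=
  if r < R_c then C_L * r ^ α_L else C_N * r ^ α_N

/-- The polar angle of a point of the plane, in `[0, 2π)`. -/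
def angle (x : Plane) : ℝ :=
  let a := Complex.arg ⟨x 0, x 1⟩
  if 0 ≤ a then a else a + 2 * Real.pi

/-- The `M` BS sectors seen from the origin (numbered from `0`). -/
def sector (M : ℕ) (i : Fin M) : Set Plane :=
  {x | angle x ∈ Set.Ico (2 * Real.pi * (i : ℝ) / M) (2 * Real.pi * ((i : ℝ) + 1) / M)}

/-- BS `k` lies in sector `i` and has the smallest path loss to the typical user (at the origin)
among all BSs in that sector. -/
def HasMinPathLoss (l : ℝ → ℝ) (M : ℕ) (x : ℕ → Plane) (i : Fin M) (k : ℕ) : Prop :=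
  x k ∈ sector M i ∧ ∀ j, x j ∈ sector M i → l ‖x k‖ ≤ l ‖x j‖

/-- BS `k` is the BS that provides the smallest path loss in sector `i`; should several BSs
attain the minimum, the one with the smallest index is taken. -/
def IsBestBS (l : ℝ → ℝ) (M : ℕ) (x : ℕ → Plane) (i : Fin M) (k : ℕ) : Prop :=
  IsLeast {k | HasMinPathLoss l M x i k} k

/-- Signal-to-noise ratio of a link of length `r` with fading `f`: transmit power `P`,
beamforming gain `M`, total noise power `W`, no interference. -/
def snr (l : ℝ → ℝ) (M : ℕ) (P W r f : ℝ) : ℝ :=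
  (f / l r) / (W / (P * M))

/-- Sector `i` is detected: it contains a BS, and the SNR of its best BS exceeds `Γ`.
Here `f k` is the fading of BS `k` in the cycle under consideration. -/
def SectorDetected (l : ℝ → ℝ) (M : ℕ) (P W Γ : ℝ) (x : ℕ → Plane) (f : ℕ → ℝ)
    (i : Fin M) : Prop :=
  ∃ k, IsBestBS l M x i k ∧ Γ < snr l M P W ‖x k‖ (f k)

/-- Cell search succeeds in a cycle if at least one sector is detected. -/
def SearchSucceeds (l : ℝ → ℝ) (M : ℕ) (P W Γ : ℝ) (x : ℕ → Plane) (f : ℕ → ℝ) : Prop :=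
  ∃ i : Fin M, SectorDetected l M P W Γ x f i

/-- The number of initial access cycles needed by the typical user to succeed in cell search,
`inf {n ≥ 1 : cell search succeeds in cycle n}`, equal to `∞` if it never succeeds.
`f n k` is the fading of BS `k` in cycle `n`. -/
def numCycles (l : ℝ → ℝ) (M : ℕ) (P W Γ : ℝ) (x : ℕ → Plane) (f : ℕ → ℕ → ℝ) : ℝ≥0∞ :=
  ⨅ (n : ℕ) (_ : 1 ≤ n ∧ SearchSucceeds l M P W Γ x (f n)), (n : ℝ≥0∞)

/-- The expected number of initial access cycles to succeed in cell search, for the typical user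
at the origin of a noise-limited network with BS locations `X` and fading `F`. -/
def expectedNumCycles {Ω : Type*} [MeasurableSpace Ω] (l : ℝ → ℝ) (M : ℕ) (P W Γ : ℝ)
    (X : ℕ → Ω → Plane) (F : ℕ → ℕ → Ω → ℝ) (μ : Measure Ω) : ℝ≥0∞ :=
  ∫⁻ ω, numCycles l M P W Γ (fun k => X k ω) (fun n k => F n k ω) ∂μ

end CellSearch

end

/-! Given the locations, cell search is a sequence of independent trials. If the nearest BS is at
distance `r`, a trial succeeds with probability of order `exp (-a r²)`, up to a factor at most `M`
for the sectors, where `a = Γ W C_N / (P M)` for large `r`. The conditional mean is thus of order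
`exp (a r²)`, while the ball of radius `r` is void with probability `exp (-λ π r²)`. The expectation
is finite or infinite according to the sign of `a - λ π`; near-field path loss plays no role.

`le_expectedNumCycles` bounds the mean below on a single void event with a free number `N` of
cycles. `expectedNumCycles_le` bounds it above by following one best BS on each annulus of width 1.
-/

namespace CellSearch

/-! ### Sectors, best BSs and detection for deterministic configurations -/

section Geometry

variable {l : ℝ → ℝ} {M : ℕ} {P W Γ : ℝ}

lemma measurable_angle : Measurable angle := by
  have h : Measurable fun x : Plane => Complex.arg ⟨x 0, x 1⟩ := by
    refine Complex.measurable_arg.comp ?_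
    have : (fun x : Plane => (⟨x 0, x 1⟩ : ℂ)) = fun x => (x 0 : ℂ) + (x 1 : ℂ) * Complex.I := by
      ext x
      apply Complex.ext <;> simp
    rw [this]
    fun_prop
  exact Measurable.ite (measurableSet_le measurable_const h) h (h.add_const _)

lemma measurableSet_sector (M : ℕ) (i : Fin M) : MeasurableSet (sector M i) :=
  measurable_angle measurableSet_Ico

lemma angle_nonneg (x : Plane) : 0 ≤ angle x := by
  unfold angle
  have := Complex.neg_pi_lt_arg ⟨x 0, x 1⟩
  have := Real.pi_pos
  dsimp only
  split_ifs with h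
  · exact h
  · linarith

lemma angle_lt_two_pi (x : Plane) : angle x < 2 * Real.pi := by
  unfold angle
  have := Complex.arg_le_pi ⟨x 0, x 1⟩
  have := Real.pi_pos
  dsimp only
  split_ifs with h
  · linarith
  · linarith

/-- The sectors cover the plane. -/
lemma exists_mem_sector (hM : 1 ≤ M) (x : Plane) : ∃ i : Fin M, x ∈ sector M i := by
  have hM' : (0 : ℝ) < M := by exact_mod_cast hM
  have hpi := Real.two_pi_pos
  have h0 : 0 ≤ angle x * M / (2 * Real.pi) := by have := angle_nonneg x; positivity
  refine ⟨⟨⌊angle x * M / (2 * Real.pi)⌋₊, ?_⟩, ?_, ?_⟩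
  · rw [Nat.floor_lt h0, div_lt_iff₀ hpi, mul_comm]
    exact mul_lt_mul_of_pos_left (angle_lt_two_pi x) hM'
  · have := Nat.floor_le h0
    rw [le_div_iff₀ hpi] at this
    rw [div_le_iff₀ hM']
    linarith
  · have := Nat.lt_floor_add_one (angle x * M / (2 * Real.pi))
    rw [div_lt_iff₀ hpi] at this
    rw [lt_div_iff₀ hM']
    linarith

lemma measurableSet_isBestBS (hl : Measurable l) (i : Fin M) (k : ℕ) :
    MeasurableSet {x : ℕ → Plane | IsBestBS l M x i k} := by
  have hsec : ∀ j, MeasurableSet {x : ℕ → Plane | x j ∈ sector M i} := fun j =>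
    measurable_pi_apply j (measurableSet_sector M i)
  have hpl : ∀ j, Measurable fun x : ℕ → Plane => l ‖x j‖ := fun j =>
    hl.comp (measurable_pi_apply j).norm
  have hmin : ∀ k, MeasurableSet {x : ℕ → Plane | HasMinPathLoss l M x i k} := by
    intro k
    have : {x : ℕ → Plane | HasMinPathLoss l M x i k} = {x | x k ∈ sector M i} ∩
        ⋂ j, ({x | x j ∈ sector M i}ᶜ ∪ {x | l ‖x k‖ ≤ l ‖x j‖}) := by
      ext x
      simp [HasMinPathLoss, imp_iff_not_or]
    rw [this]
    exact (hsec k).inter (.iInter fun j => (hsec j).compl.union (measurableSet_le (hpl k) (hpl j)))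
  have : {x : ℕ → Plane | IsBestBS l M x i k} = {x | HasMinPathLoss l M x i k} ∩
      ⋂ j, ({x | HasMinPathLoss l M x i j}ᶜ ∪ {_x | k ≤ j}) := by
    ext x
    simp [IsBestBS, IsLeast, lowerBounds, imp_iff_not_or]
  rw [this]
  exact (hmin k).inter (.iInter fun j => (hmin j).compl.union (.const _))

/-- In a locally finite configuration with a point in `ball 0 r`, some sector has a best BS, the
path loss of which is at most `l r`. -/
lemma exists_isBestBS (hM : 1 ≤ M) (hmono : MonotoneOn l (Set.Ici 0)) {x : ℕ → Plane} {r : ℝ}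
    (hfin : {k | ‖x k‖ < r}.Finite) {k₀ : ℕ} (hk₀ : ‖x k₀‖ < r) :
    ∃ i k, IsBestBS l M x i k ∧ l ‖x k‖ ≤ l r := by
  obtain ⟨i, hi⟩ := exists_mem_sector hM (x k₀)
  -- Minimising over the finitely many points in the ball suffices: by monotonicity, points outside
  -- have no smaller path loss.
  obtain ⟨k, ⟨hkr, hki⟩, hk⟩ := (hfin.inter_of_left {k | x k ∈ sector M i}).exists_minimalFor
    (fun k => l ‖x k‖) _ ⟨k₀, hk₀, hi⟩
  have hr : 0 ≤ r := (norm_nonneg _).trans hk₀.le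
  have hkmin : HasMinPathLoss l M x i k := by
    refine ⟨hki, fun j hj => ?_⟩
    rcases lt_or_ge ‖x j‖ r with h | h
    · exact (le_total _ _).elim id (fun h' => hk ⟨h, hj⟩ h')
    · exact hmono (norm_nonneg _) (norm_nonneg _) (hkr.le.trans h)
  classical
  have hex : ∃ k, HasMinPathLoss l M x i k := ⟨k, hkmin⟩
  refine ⟨i, Nat.find hex, ⟨Nat.find_spec hex, fun j hj => Nat.find_min' hex hj⟩, ?_⟩
  exact ((Nat.find_spec hex).2 _ hi).trans (hmono (norm_nonneg _) hr hk₀.le)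

/-- The fading needed on a link of path loss `a` to be detected. -/
noncomputable def fadingThreshold (M : ℕ) (P W Γ a : ℝ) : ℝ := Γ * (W / (P * M)) * a

lemma fadingThreshold_mono (hP : 0 < P) (hW : 0 < W) (hΓ : 0 < Γ) :
    Monotone (fadingThreshold M P W Γ) := fun a b h => by
  unfold fadingThreshold
  gcongr

lemma lt_snr_iff (hM : 1 ≤ M) (hP : 0 < P) (hW : 0 < W) {r f : ℝ} (hr : 0 < l r) :
    Γ < snr l M P W r f ↔ fadingThreshold M P W Γ (l r) < f := by
  have hM' : (0 : ℝ) < M := by exact_mod_cast hM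
  unfold snr fadingThreshold
  rw [lt_div_iff₀ (by positivity), lt_div_iff₀ hr]

lemma le_numCycles {x : ℕ → Plane} {f : ℕ → ℕ → ℝ} {N : ℕ}
    (h : ∀ n < N, ¬ SearchSucceeds l M P W Γ x (f n)) :
    (N : ℝ≥0∞) ≤ numCycles l M P W Γ x f := by
  refine le_iInf₂ fun n hn => ?_
  have : N ≤ n := not_lt.1 fun hlt => h n hlt hn.2
  exact_mod_cast this

/-- The number of cycles is at most the number of initial runs of failures of a best BS. -/
lemma numCycles_le_tsum (hM : 1 ≤ M) (hP : 0 < P) (hW : 0 < W) (hΓ : 0 < Γ)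
    (hpos : ∀ r, 0 < r → 0 < l r)
    {x : ℕ → Plane} {f : ℕ → ℕ → ℝ} {i : Fin M} {k : ℕ} {a : ℝ}
    (hbest : IsBestBS l M x i k) (hk : x k ≠ 0) (ha : l ‖x k‖ ≤ a) :
    numCycles l M P W Γ x f ≤
      ∑' n : ℕ, {f : ℕ → ℕ → ℝ | ∀ m ∈ Finset.Icc 1 n,
        f m k ≤ fadingThreshold M P W Γ a}.indicator 1 f := by
  have hfail : ∀ m, ¬ SearchSucceeds l M P W Γ x (f m) → f m k ≤ fadingThreshold M P W Γ a := by
    intro m hm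
    by_contra! hlt
    refine hm ⟨i, k, hbest, ?_⟩
    rw [lt_snr_iff hM hP hW (hpos _ (norm_pos_iff.2 hk))]
    exact (fadingThreshold_mono hP hW hΓ ha).trans_lt hlt
  by_cases hex : ∃ n, 1 ≤ n ∧ SearchSucceeds l M P W Γ x (f n)
  · classical
    calc numCycles l M P W Γ x f ≤ (Nat.find hex : ℝ≥0∞) := iInf₂_le (f := fun (n : ℕ) _ => (n : ℝ≥0∞)) _ (Nat.find_spec hex)
      _ = ∑ n ∈ Finset.range (Nat.find hex), (1 : ℝ≥0∞) := by simp
      _ ≤ ∑ n ∈ Finset.range (Nat.find hex), _ := ?_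
      _ ≤ _ := ENNReal.sum_le_tsum _
    -- Tail-sum formula: for each `n` below the first success, cycles `1, …, n` all fail, so the
    -- `n`-th indicator is 1 (vacuously for `n = 0`).
    refine Finset.sum_le_sum fun n hn => ?_
    rw [Set.indicator_of_mem]
    · simp
    · intro m hm
      rw [Finset.mem_Icc] at hm
      have := Nat.find_min hex (hm.2.trans_lt (Finset.mem_range.1 hn))
      exact hfail m fun h => this ⟨hm.1, h⟩
  · push Not at hex
    have : ∀ n : ℕ, {f : ℕ → ℕ → ℝ | ∀ m ∈ Finset.Icc 1 n,
        f m k ≤ fadingThreshold M P W Γ a}.indicator (1 : (ℕ → ℕ → ℝ) → ℝ≥0∞) f = 1 := by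
      intro n
      rw [Set.indicator_of_mem, Pi.one_apply]
      exact fun m hm => hfail m (hex m (Finset.mem_Icc.1 hm).1)
    rw [tsum_congr this, ENNReal.tsum_const_eq_top_of_ne_zero one_ne_zero]
    exact le_top

end Geometry

/-! ### Void probabilities and local finiteness -/

section Poisson

variable {Ω : Type*} [MeasurableSpace Ω] {μ : Measure Ω} {X : ℕ → Ω → Plane} {ν : Measure Plane}

lemma countingMeasure_eq_zero_iff {x : ℕ → Plane} {B : Set Plane} (hB : MeasurableSet B) :
    countingMeasure x B = 0 ↔ ∀ k, x k ∉ B := by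
  simp [countingMeasure, Measure.sum_apply _ hB, hB]

lemma finite_of_countingMeasure_ne_top {x : ℕ → Plane} {B : Set Plane} (hB : MeasurableSet B)
    (h : countingMeasure x B ≠ ∞) : {k | x k ∈ B}.Finite := by
  rw [countingMeasure, Measure.sum_apply _ hB] at h
  refine (ENNReal.finite_const_le_of_tsum_ne_top h one_ne_zero).subset fun k hk => ?_
  simp_all

/-- Void probabilities of a Poisson point process. -/
lemma IsPoissonPointProcess.measure_void (hX : IsPoissonPointProcess X ν μ) {B : Set Plane}
    (hB : MeasurableSet B) (hν : ν B ≠ ∞) :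
    μ {ω | ∀ k, X k ω ∉ B} = ENNReal.ofReal (Real.exp (-(ν B).toReal)) := by
  have h := (hX.hasLaw_count B hB hν).measure_eq (p := fun c => c = 0) (measurableSet_singleton 0)
  simp only [countingMeasure_eq_zero_iff hB] at h
  rw [h, Measure.map_apply (s := {c | c = 0}) .of_discrete (measurableSet_singleton 0)]
  have : (fun n : ℕ => (n : ℝ≥0∞)) ⁻¹' {c | c = 0} = {0} := by ext; simp
  rw [this, poissonMeasure_singleton]
  simp [ENNReal.coe_toNNReal_eq_toReal]

lemma IsPoissonPointProcess.ae_finite (hX : IsPoissonPointProcess X ν μ) {B : Set Plane}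
    (hB : MeasurableSet B) (hν : ν B ≠ ∞) :
    ∀ᵐ ω ∂μ, {k | X k ω ∈ B}.Finite := by
  have h := (hX.hasLaw_count B hB hν).measure_eq (p := fun c => c = ∞) (measurableSet_singleton ∞)
  rw [Measure.map_apply (s := {c | c = ∞}) .of_discrete (measurableSet_singleton ∞)] at h
  have h' : (fun n : ℕ => (n : ℝ≥0∞)) ⁻¹' {c | c = ∞} = ∅ := by ext; simp
  rw [h', measure_empty] at h
  filter_upwards [measure_eq_zero_iff_ae_notMem.1 h] with ω hω
  exact finite_of_countingMeasure_ne_top hB hω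

lemma IsPoissonPointProcess.ae_notMem [IsProbabilityMeasure μ] (hX : IsPoissonPointProcess X ν μ)
    {B : Set Plane} (hB : MeasurableSet B) (hν : ν B = 0) :
    ∀ᵐ ω ∂μ, ∀ k, X k ω ∉ B := by
  have h := hX.measure_void hB (by simp [hν])
  have hm : MeasurableSet {ω | ∀ k, X k ω ∉ B} := by
    simp only [Set.ofPred_forall]
    exact .iInter fun k => (hX.measurable k hB).compl
  exact (mem_ae_iff_prob_eq_one hm).2 (by simpa [hν] using h)

end Poisson

/-! ### Fading on events determined by the locations -/

section Fading

lemma expMeasure_one_Iic {t : ℝ} (ht : 0 ≤ t) :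
    expMeasure 1 (Set.Iic t) = ENNReal.ofReal (1 - Real.exp (-t)) := by
  have := isProbabilityMeasure_expMeasure one_pos
  rw [← ofReal_cdf, cdf_expMeasure_eq one_pos, if_pos ht, one_mul]

lemma expMeasure_one_Ioi {t : ℝ} (ht : 0 ≤ t) :
    expMeasure 1 (Set.Ioi t) = ENNReal.ofReal (Real.exp (-t)) := by
  have := isProbabilityMeasure_expMeasure one_pos
  rw [← Set.compl_Iic, prob_compl_eq_one_sub measurableSet_Iic, expMeasure_one_Iic ht,
    ← ENNReal.ofReal_one, ← ENNReal.ofReal_sub _ (by simpa using ht), sub_sub_cancel]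

variable {Ω : Type*} [MeasurableSpace Ω] {μ : Measure Ω} {X : ℕ → Ω → Plane}
  {F : ℕ → ℕ → Ω → ℝ} {lam : ℝ}

lemma IsRayleighPoissonNetwork.measurable_locations (h : IsRayleighPoissonNetwork X F lam μ) :
    Measurable fun ω k => X k ω :=
  measurable_pi_iff.2 h.poisson.measurable

/-- Being the best BS is an event of the locations alone, so on it the fading of BS `k` is still
exponential. Splitting over fixed `k` thus replaces conditioning on a random index. -/
lemma IsRayleighPoissonNetwork.measure_inter_fading_gt (h : IsRayleighPoissonNetwork X F lam μ)
    {S : Set (ℕ → Plane)} (hS : MeasurableSet S) (n k : ℕ) {t : ℝ} (ht : 0 ≤ t) :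
    μ ({ω | (fun k => X k ω) ∈ S} ∩ {ω | t < F n k ω}) =
      μ {ω | (fun k => X k ω) ∈ S} * ENNReal.ofReal (Real.exp (-t)) := by
  have h1 := h.indep.measure_inter_preimage_eq_mul S {f | t < f (n, k)} hS
    (measurableSet_lt measurable_const (measurable_pi_apply _))
  have h2 : μ {ω | t < F n k ω} = expMeasure 1 (Set.Ioi t) :=
    (h.fading_law n k).measure_eq (p := fun x => t < x) measurableSet_Ioi
  rw [← expMeasure_one_Ioi ht, ← h2]
  exact h1

lemma IsRayleighPoissonNetwork.measure_inter_fading_le (h : IsRayleighPoissonNetwork X F lam μ)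
    {S : Set (ℕ → Plane)} (hS : MeasurableSet S) (n k : ℕ) {t : ℝ} (ht : 0 ≤ t) :
    μ ({ω | (fun k => X k ω) ∈ S} ∩ {ω | ∀ m ∈ Finset.Icc 1 n, F m k ω ≤ t}) =
      μ {ω | (fun k => X k ω) ∈ S} * ENNReal.ofReal (1 - Real.exp (-t)) ^ n := by
  have hT : MeasurableSet {f : ℕ × ℕ → ℝ | ∀ m ∈ Finset.Icc 1 n, f (m, k) ≤ t} := by
    have : {f : ℕ × ℕ → ℝ | ∀ m ∈ Finset.Icc 1 n, f (m, k) ≤ t} =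
        ⋂ m ∈ Finset.Icc 1 n, {f | f (m, k) ≤ t} := by ext; simp
    rw [this]
    exact Finset.measurableSet_biInter _ fun m _ =>
      measurableSet_le (measurable_pi_apply _) measurable_const
  have h1 := h.indep.measure_inter_preimage_eq_mul S _ hS hT
  have hcol : iIndepFun (fun m => F m k) μ :=
    h.fading_indep.precomp (g := fun m : ℕ => (m, k)) fun a b hab => (Prod.mk.inj hab).1
  have h2 := hcol.measure_inter_preimage_eq_mul (Finset.Icc 1 n) (sets := fun _ => Set.Iic t)
    fun _ _ => measurableSet_Iic
  have h3 : ∀ m, μ (F m k ⁻¹' Set.Iic t) = ENNReal.ofReal (1 - Real.exp (-t)) := fun m => by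
    rw [← expMeasure_one_Iic ht]
    exact (h.fading_law m k).measure_eq (p := fun x => x ≤ t) measurableSet_Iic
  simp only [h3, Finset.prod_const, Nat.card_Icc, add_tsub_cancel_right] at h2
  rw [← h2]
  have h4 : (⋂ m ∈ Finset.Icc 1 n, F m k ⁻¹' Set.Iic t) =
      {ω | ∀ m ∈ Finset.Icc 1 n, F m k ω ≤ t} := by ext; simp
  rw [h4]
  exact h1

lemma IsRayleighPoissonNetwork.measure_void_ball (h : IsRayleighPoissonNetwork X F lam μ)
    (hlam : 0 ≤ lam) {r : ℝ} (hr : 0 ≤ r) :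
    μ {ω | ∀ k, r ≤ ‖X k ω‖} = ENNReal.ofReal (Real.exp (-(lam * Real.pi * r ^ 2))) := by
  have hv : (ENNReal.ofReal lam • (volume : Measure Plane)) (Metric.ball 0 r) =
      ENNReal.ofReal (lam * Real.pi * r ^ 2) := by
    rw [Measure.smul_apply, EuclideanSpace.volume_ball_fin_two, smul_eq_mul,
      ← ENNReal.ofReal_pow hr, ← ENNReal.ofReal_mul (by positivity), ← ENNReal.ofReal_mul hlam]
    ring_nf
  have := h.poisson.measure_void (B := Metric.ball 0 r) measurableSet_ball (by simp [hv])
  rw [hv, ENNReal.toReal_ofReal (by positivity)] at this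
  simpa using this

lemma IsRayleighPoissonNetwork.ae_finite_ball (h : IsRayleighPoissonNetwork X F lam μ) :
    ∀ᵐ ω ∂μ, ∀ n : ℕ, {k | ‖X k ω‖ < n}.Finite := by
  refine ae_all_iff.2 fun n => ?_
  have hv : (ENNReal.ofReal lam • (volume : Measure Plane)) (Metric.ball 0 n) ≠ ∞ := by
    rw [Measure.smul_apply, smul_eq_mul]
    exact ENNReal.mul_ne_top ENNReal.ofReal_ne_top measure_ball_lt_top.ne
  simpa using h.poisson.ae_finite measurableSet_ball hv

/-- The path loss may vanish at the origin, where `snr` takes the default value 0 of division by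
zero and detection fails. -/
lemma IsRayleighPoissonNetwork.ae_ne_zero [IsProbabilityMeasure μ]
    (h : IsRayleighPoissonNetwork X F lam μ) : ∀ᵐ ω ∂μ, ∀ k, X k ω ≠ 0 := by
  simpa using h.poisson.ae_notMem (measurableSet_singleton 0) (by simp)

end Fading

/-! ### Lower and upper bounds for the expected number of cycles -/

section Bounds

variable {Ω : Type*} [MeasurableSpace Ω] {μ : Measure Ω} {X : ℕ → Ω → Plane}
  {F : ℕ → ℕ → Ω → ℝ} {lam : ℝ} {l : ℝ → ℝ} {M : ℕ} {P W Γ : ℝ}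

/-- Configurations without a point in the open ball of radius `r` around the origin. -/
def voidBall (r : ℝ) : Set (ℕ → Plane) := {x | ∀ k, r ≤ ‖x k‖}

lemma measurableSet_voidBall (r : ℝ) : MeasurableSet (voidBall r) := by
  unfold voidBall
  simp only [Set.ofPred_forall]
  exact .iInter fun k => measurableSet_le measurable_const (measurable_pi_apply k).norm

/-- Union bound for the success of a cycle when the ball of radius `r` is void. -/
lemma IsRayleighPoissonNetwork.measure_void_inter_success_le
    (h : IsRayleighPoissonNetwork X F lam μ) (hl : Measurable l) (n : ℕ) (r : ℝ) {t : ℝ}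
    (ht : 0 ≤ t) :
    μ (⋃ (i : Fin M) (k : ℕ), ({ω | (fun k => X k ω) ∈ {x | IsBestBS l M x i k} ∩ voidBall r} ∩
      {ω | t < F n k ω})) ≤
      M * (μ {ω | (fun k => X k ω) ∈ voidBall r} * ENNReal.ofReal (Real.exp (-t))) := by
  have hS : ∀ (i : Fin M) k, MeasurableSet ({x | IsBestBS l M x i k} ∩ voidBall r) := fun i k =>
    (measurableSet_isBestBS hl i k).inter (measurableSet_voidBall r)
  calc _ ≤ ∑ i : Fin M, ∑' k : ℕ, μ ({ω | (fun k => X k ω) ∈ {x | IsBestBS l M x i k} ∩ voidBall r} ∩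
          {ω | t < F n k ω}) :=
        (measure_iUnion_fintype_le _ _).trans (Finset.sum_le_sum fun i _ => measure_iUnion_le _)
    _ ≤ ∑ i : Fin M, μ {ω | (fun k => X k ω) ∈ voidBall r} * ENNReal.ofReal (Real.exp (-t)) := by
        refine Finset.sum_le_sum fun i _ => ?_
        simp_rw [h.measure_inter_fading_gt (hS i _) n _ ht]
        rw [ENNReal.tsum_mul_right]
        gcongr
        -- Each sector has at most one best BS, so the events are disjoint in `k` and the infinite
        -- sum costs no more than the void probability.
        rw [← measure_iUnion]
        · refine measure_mono (Set.iUnion_subset fun k ω hω => hω.2)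
        · intro k k' hkk'
          exact Set.disjoint_left.2 fun ω hω hω' => hkk' (hω.1.unique hω'.1)
        · exact fun k => h.measurable_locations (hS i k)
    _ = _ := by simp

/-- On the event that the ball of radius `r` is void, `N` cycles probably do not suffice. -/
lemma IsRayleighPoissonNetwork.le_expectedNumCycles [IsProbabilityMeasure μ]
    (h : IsRayleighPoissonNetwork X F lam μ)
    (hM : 1 ≤ M) (hlam : 0 ≤ lam) (hP : 0 < P) (hW : 0 < W) (hΓ : 0 < Γ)
    (hl : Measurable l) (hmono : MonotoneOn l (Set.Ici 0)) (hpos : ∀ r, 0 < r → 0 < l r)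
    {r : ℝ} (hr : 0 < r) (N : ℕ) :
    ENNReal.ofReal (N * (Real.exp (-(lam * Real.pi * r ^ 2)) - N * (M *
      (Real.exp (-(lam * Real.pi * r ^ 2)) * Real.exp (-fadingThreshold M P W Γ (l r)))))) ≤
      expectedNumCycles l M P W Γ X F μ := by
  set t := fadingThreshold M P W Γ (l r) with htdef
  have ht : 0 ≤ t := by
    have := hpos r hr
    rw [htdef, fadingThreshold]
    positivity
  have hA : μ {ω | (fun k => X k ω) ∈ voidBall r} =
      ENNReal.ofReal (Real.exp (-(lam * Real.pi * r ^ 2))) := h.measure_void_ball hlam hr.le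
  set A := {ω | (fun k => X k ω) ∈ voidBall r} with hAdef
  let U : ℕ → Set Ω := fun n => ⋃ (i : Fin M) (k : ℕ),
    ({ω | (fun k => X k ω) ∈ {x | IsBestBS l M x i k} ∩ voidBall r} ∩ {ω | t < F n k ω})
  have hAm : MeasurableSet A := h.measurable_locations (measurableSet_voidBall r)
  have hUm : ∀ n, MeasurableSet (U n) := fun n => .iUnion fun i => .iUnion fun k =>
    (h.measurable_locations ((measurableSet_isBestBS hl i k).inter (measurableSet_voidBall r))).inter
      (measurableSet_lt measurable_const (h.fading_measurable n k))
  have hUle : ∀ n, μ (U n) ≤ M * (μ A * ENNReal.ofReal (Real.exp (-t))) := fun n =>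
    h.measure_void_inter_success_le hl n r ht
  have hsub : ∀ ω ∈ A \ ⋃ n ∈ Finset.range N, U n,
      (N : ℝ≥0∞) ≤ numCycles l M P W Γ (fun k => X k ω) (fun n k => F n k ω) := by
    rintro ω ⟨hωA, hωU⟩
    refine le_numCycles fun n hn ⟨i, k, hbest, hsnr⟩ => hωU ?_
    have hrk : r ≤ ‖X k ω‖ := hωA k
    rw [lt_snr_iff hM hP hW (hpos _ (hr.trans_le hrk))] at hsnr
    refine Set.mem_biUnion (Finset.mem_coe.2 (Finset.mem_range.2 hn)) ?_
    refine Set.mem_iUnion₂.2 ⟨i, k, ⟨hbest, hωA⟩, ?_⟩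
    exact (fadingThreshold_mono hP hW hΓ (hmono hr.le (hr.le.trans hrk) hrk)).trans_lt hsnr
  calc _ = N * (μ A - N * (M * (μ A * ENNReal.ofReal (Real.exp (-t))))) := by
        rw [hA, ENNReal.ofReal_mul (by positivity), ENNReal.ofReal_sub _ (by positivity),
          ENNReal.ofReal_mul (by positivity), ENNReal.ofReal_mul (by positivity),
          ENNReal.ofReal_mul (by positivity), ENNReal.ofReal_natCast, ENNReal.ofReal_natCast]
    _ ≤ N * (μ A - μ (⋃ n ∈ Finset.range N, U n)) := by
        gcongr
        calc _ ≤ ∑ n ∈ Finset.range N, μ (U n) := measure_biUnion_finset_le _ _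
          _ ≤ ∑ n ∈ Finset.range N, M * (μ A * ENNReal.ofReal (Real.exp (-t))) :=
              Finset.sum_le_sum fun n _ => hUle n
          _ = _ := by simp
    _ ≤ N * μ (A \ ⋃ n ∈ Finset.range N, U n) := by
        gcongr
        exact le_measure_sdiff
    _ = ∫⁻ ω, (A \ ⋃ n ∈ Finset.range N, U n).indicator (fun _ => (N : ℝ≥0∞)) ω ∂μ := by
        rw [lintegral_indicator_const
          (hAm.diff (Finset.measurableSet_biUnion _ fun n _ => hUm n))]
    _ ≤ _ := by
        refine lintegral_mono fun ω => ?_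
        by_cases hω : ω ∈ A \ ⋃ n ∈ Finset.range N, U n
        · rw [Set.indicator_of_mem hω]
          exact hsub ω hω
        · rw [Set.indicator_of_notMem hω]
          exact zero_le

/-- Upper bound by splitting according to the integer part of the distance to the nearest BS. -/
lemma IsRayleighPoissonNetwork.expectedNumCycles_le [IsProbabilityMeasure μ]
    (h : IsRayleighPoissonNetwork X F lam μ)
    (hM : 1 ≤ M) (hlam : 0 ≤ lam) (hP : 0 < P) (hW : 0 < W) (hΓ : 0 < Γ)
    (hl : Measurable l) (hmono : MonotoneOn l (Set.Ici 0)) (hpos : ∀ r, 0 < r → 0 < l r) :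
    expectedNumCycles l M P W Γ X F μ ≤
      ∑' j : ℕ, ENNReal.ofReal (Real.exp (-(lam * Real.pi * j ^ 2)) *
        Real.exp (fadingThreshold M P W Γ (l (j + 1)))) := by
  let t : ℕ → ℝ := fun j => fadingThreshold M P W Γ (l (j + 1))
  have ht : ∀ j, 0 ≤ t j := fun j => by
    have := hpos (j + 1) (by positivity)
    simp only [t, fadingThreshold]
    positivity
  let D : ℕ → ℕ → Set (ℕ → Plane) := fun j k =>
    (⋃ i, {x | IsBestBS l M x i k}) ∩ {x | l ‖x k‖ ≤ l (j + 1)}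
  have hD : ∀ j k, MeasurableSet (D j k) := fun j k =>
    (MeasurableSet.iUnion fun i => measurableSet_isBestBS hl i k).inter
      (measurableSet_le (hl.comp (measurable_pi_apply k).norm) measurable_const)
  -- Several sectors may offer a suitable best BS; `disjointed` keeps the one of least index, making
  -- these sets disjoint in `k`.
  let C : ℕ → ℕ → Set (ℕ → Plane) := fun j k => voidBall j ∩ disjointed (D j) k
  have hC : ∀ j k, MeasurableSet (C j k) := fun j k =>
    (measurableSet_voidBall j).inter (.disjointed (hD j) k)
  let V : ℕ → ℕ → ℕ → Set Ω := fun j k n =>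
    {ω | (fun k => X k ω) ∈ C j k} ∩ {ω | ∀ m ∈ Finset.Icc 1 n, F m k ω ≤ t j}
  have hV : ∀ j k n, MeasurableSet (V j k n) := fun j k n => by
    refine (h.measurable_locations (hC j k)).inter ?_
    simp only [Set.ofPred_forall]
    exact .iInter fun m => .iInter fun _ =>
      measurableSet_le (h.fading_measurable m k) measurable_const
  have hle : ∀ᵐ ω ∂μ, numCycles l M P W Γ (fun k => X k ω) (fun n k => F n k ω) ≤
      ∑' (j : ℕ) (k : ℕ) (n : ℕ), (V j k n).indicator 1 ω := by
    filter_upwards [h.ae_finite_ball, h.ae_ne_zero] with ω hfin hne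
    have hex : ∃ j : ℕ, ∃ k, ‖X k ω‖ < j + 1 :=
      ⟨⌊‖X 0 ω‖⌋₊, 0, Nat.lt_floor_add_one _⟩
    classical
    obtain ⟨k₀, hk₀⟩ := Nat.find_spec hex
    have hvoid : (fun k => X k ω) ∈ voidBall (Nat.find hex : ℝ) := by
      intro k
      by_contra! hlt
      rcases Nat.eq_zero_or_pos (Nat.find hex) with h0 | h0
      · rw [h0, Nat.cast_zero] at hlt
        exact (norm_nonneg _).not_gt hlt
      · refine Nat.find_min hex (Nat.sub_lt h0 one_pos) ⟨k, ?_⟩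
        rwa [Nat.cast_pred h0, sub_add_cancel]
    set j := Nat.find hex
    obtain ⟨i, k, hbest, hlk⟩ := exists_isBestBS hM hmono (x := fun k => X k ω)
      (by simpa using hfin (j + 1)) hk₀
    have hmem : (fun k => X k ω) ∈ ⋃ k, disjointed (D j) k := by
      rw [iUnion_disjointed]
      exact Set.mem_iUnion.2 ⟨k, Set.mem_iUnion.2 ⟨i, hbest⟩, hlk⟩
    obtain ⟨k', hk'⟩ := Set.mem_iUnion.1 hmem
    obtain ⟨hbest', hlk'⟩ := disjointed_subset (D j) k' hk'
    obtain ⟨i', hi'⟩ := Set.mem_iUnion.1 hbest'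
    calc _ ≤ _ := numCycles_le_tsum hM hP hW hΓ hpos hi' (hne k') hlk'
      _ = ∑' n : ℕ, (V j k' n).indicator 1 ω := by
          refine tsum_congr fun n => ?_
          refine Set.indicator_eq_indicator ?_ rfl
          exact ⟨fun hf => ⟨⟨hvoid, hk'⟩, hf⟩, fun hf => hf.2⟩
      _ ≤ ∑' (k : ℕ) (n : ℕ), (V j k n).indicator 1 ω :=
          ENNReal.le_tsum (f := fun k => ∑' n : ℕ, (V j k n).indicator 1 ω) k'
      _ ≤ _ := ENNReal.le_tsum (f := fun j => ∑' (k : ℕ) (n : ℕ), (V j k n).indicator 1 ω) j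
  have hV1 : ∀ j k n, Measurable ((V j k n).indicator (1 : Ω → ℝ≥0∞)) := fun j k n =>
    measurable_one.indicator (hV j k n)
  calc expectedNumCycles l M P W Γ X F μ
      ≤ ∫⁻ ω, ∑' (j : ℕ) (k : ℕ) (n : ℕ), (V j k n).indicator 1 ω ∂μ := lintegral_mono_ae hle
    _ = ∑' (j : ℕ) (k : ℕ) (n : ℕ), μ (V j k n) := by
        rw [lintegral_tsum fun j => (Measurable.tsum fun k =>
          .tsum fun n => hV1 j k n).aemeasurable]
        refine tsum_congr fun j => ?_
        rw [lintegral_tsum fun k => (Measurable.tsum fun n => hV1 j k n).aemeasurable]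
        refine tsum_congr fun k => ?_
        rw [lintegral_tsum fun n => (hV1 j k n).aemeasurable]
        exact tsum_congr fun n => lintegral_indicator_one (hV j k n)
    _ = ∑' j : ℕ, (∑' k : ℕ, μ {ω | (fun k => X k ω) ∈ C j k}) *
          ENNReal.ofReal (Real.exp (t j)) := by
        refine tsum_congr fun j => ?_
        rw [← ENNReal.tsum_mul_right]
        refine tsum_congr fun k => ?_
        simp_rw [V, h.measure_inter_fading_le (hC j k) _ k (ht j)]
        -- The geometric series with ratio `1 - exp (-t j)` sums to `exp (t j)`.
        rw [ENNReal.tsum_mul_left, ENNReal.tsum_geometric, ← ENNReal.ofReal_one,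
          ← ENNReal.ofReal_sub _ (by simpa using ht j), sub_sub_cancel,
          ← ENNReal.ofReal_inv_of_pos (Real.exp_pos _), Real.exp_neg, inv_inv]
    _ ≤ ∑' j : ℕ, μ {ω | (fun k => X k ω) ∈ voidBall j} * ENNReal.ofReal (Real.exp (t j)) := by
        refine ENNReal.tsum_le_tsum fun j => ?_
        gcongr
        rw [← measure_iUnion]
        · exact measure_mono (Set.iUnion_subset fun k ω hω => hω.1)
        · intro k k' hkk'
          exact Set.disjoint_left.2 fun ω hω hω' =>
            Set.disjoint_left.1 (disjoint_disjointed (D j) hkk') hω.2 hω'.2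
        · exact fun k => h.measurable_locations (hC j k)
    _ = _ := by
        refine tsum_congr fun j => ?_
        rw [ENNReal.ofReal_mul (by positivity)]
        congr 1
        exact h.measure_void_ball hlam j.cast_nonneg

/-- Below the threshold, the void probabilities decay too slowly. -/
lemma IsRayleighPoissonNetwork.expectedNumCycles_eq_top [IsProbabilityMeasure μ]
    (h : IsRayleighPoissonNetwork X F lam μ)
    (hM : 1 ≤ M) (hlam : 0 ≤ lam) (hP : 0 < P) (hW : 0 < W) (hΓ : 0 < Γ)
    (hl : Measurable l) (hmono : MonotoneOn l (Set.Ici 0)) (hpos : ∀ r, 0 < r → 0 < l r)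
    {a R : ℝ} (hR : ∀ r, R ≤ r → fadingThreshold M P W Γ (l r) = a * r ^ 2)
    (ha : lam * Real.pi < a) :
    expectedNumCycles l M P W Γ X F μ = ∞ := by
  have hM' : (0 : ℝ) < M := by exact_mod_cast hM
  have hlim : Filter.Tendsto (fun r : ℝ => ENNReal.ofReal
      (Real.exp ((a - lam * Real.pi) * r ^ 2) / (4 * M) - 1 / 2)) Filter.atTop (nhds ∞) := by
    refine ENNReal.tendsto_ofReal_atTop.comp (Filter.tendsto_atTop_add_const_right _ _ ?_)
    refine Filter.Tendsto.atTop_div_const (by positivity) (Real.tendsto_exp_atTop.comp ?_)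
    exact (Filter.tendsto_pow_atTop two_ne_zero).const_mul_atTop (sub_pos.2 ha)
  refine top_le_iff.1 (le_of_tendsto hlim ?_)
  filter_upwards [Filter.eventually_ge_atTop R, Filter.eventually_gt_atTop 0] with r hrR hr
  -- With this `N` the union bound over `N` cycles loses at most half of the void probability `p`,
  -- leaving `N * p / 2`. The floor costs at most `p / 2 ≤ 1 / 2`, hence the `- 1 / 2` in `hlim`.
  set N := ⌊Real.exp (a * r ^ 2) / (2 * M)⌋₊
  refine le_trans (ENNReal.ofReal_le_ofReal ?_)
    (h.le_expectedNumCycles hM hlam hP hW hΓ hl hmono hpos hr N)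
  rw [hR r hrR]
  have hN1 : (N : ℝ) ≤ Real.exp (a * r ^ 2) / (2 * M) := Nat.floor_le (by positivity)
  have hN2 : Real.exp (a * r ^ 2) / (2 * M) - 1 ≤ N := (Nat.sub_one_lt_floor _).le
  set p := Real.exp (-(lam * Real.pi * r ^ 2)) with hp
  have hp0 : 0 < p := Real.exp_pos _
  have hp1 : p ≤ 1 := Real.exp_le_one_iff.2 (by have := Real.pi_pos; simp; positivity)
  have hNe : (N : ℝ) * (M * Real.exp (-(a * r ^ 2))) ≤ 1 / 2 := by
    calc _ ≤ Real.exp (a * r ^ 2) / (2 * M) * (M * Real.exp (-(a * r ^ 2))) := by gcongr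
      _ = _ := by rw [Real.exp_neg]; field_simp
  have hexp : Real.exp ((a - lam * Real.pi) * r ^ 2) = Real.exp (a * r ^ 2) * p := by
    rw [hp, ← Real.exp_add]
    ring_nf
  calc _ = (Real.exp (a * r ^ 2) / (2 * M)) * (p / 2) - 1 / 2 := by
        rw [hexp]; field_simp; ring
    _ ≤ (Real.exp (a * r ^ 2) / (2 * M)) * (p / 2) - p / 2 := by linarith
    _ = (Real.exp (a * r ^ 2) / (2 * M) - 1) * (p / 2) := by ring
    _ ≤ N * (p / 2) := by gcongr
    _ ≤ N * (p * (1 - N * (M * Real.exp (-(a * r ^ 2))))) := by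
        gcongr
        nlinarith
    _ = _ := by ring

/-- Above the threshold, the bounds for the annuli are summable. -/
lemma IsRayleighPoissonNetwork.expectedNumCycles_lt_top [IsProbabilityMeasure μ]
    (h : IsRayleighPoissonNetwork X F lam μ)
    (hM : 1 ≤ M) (hlam : 0 ≤ lam) (hP : 0 < P) (hW : 0 < W) (hΓ : 0 < Γ)
    (hl : Measurable l) (hmono : MonotoneOn l (Set.Ici 0)) (hpos : ∀ r, 0 < r → 0 < l r)
    {a R : ℝ} (hR : ∀ r, R ≤ r → fadingThreshold M P W Γ (l r) = a * r ^ 2)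
    (ha : a < lam * Real.pi) :
    expectedNumCycles l M P W Γ X F μ < ∞ := by
  refine (h.expectedNumCycles_le hM hlam hP hW hΓ hl hmono hpos).trans_lt ?_
  refine lt_top_iff_ne_top.2 (Summable.tsum_ofReal_ne_top ?_)
  refine Summable.of_norm_bounded_eventually_nat Real.summable_exp_neg_nat ?_
  have hlim : Filter.Tendsto (fun j : ℕ => (j : ℝ)) Filter.atTop Filter.atTop :=
    tendsto_natCast_atTop_atTop
  -- The exponent must satisfy `a (j + 1)² - λ π j² ≤ -j`, that is `(λ π - a) j² ≥ (2 a + 1) j + a`.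
  -- For `j ≥ 1` the right side is at most `(2 |a| + 1 + |a|) j`, which gives the last bound on `j`.
  filter_upwards [hlim.eventually_ge_atTop R, hlim.eventually_ge_atTop 1,
    hlim.eventually_ge_atTop ((2 * |a| + 1 + |a|) / (lam * Real.pi - a))] with j hjR hj1 hj
  rw [hR _ (by linarith), ← Real.exp_add, Real.norm_of_nonneg (Real.exp_pos _).le,
    Real.exp_le_exp]
  rw [div_le_iff₀ (sub_pos.2 ha)] at hj
  have h1 := le_abs_self a
  have h2 := abs_nonneg a
  nlinarith [mul_le_mul_of_nonneg_right hj (zero_le_one.trans hj1),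
    mul_le_mul_of_nonneg_right h1 (zero_le_one.trans hj1),
    mul_le_mul_of_nonneg_left hj1 h2]

end Bounds

/-! ### The dual-slope path loss and the phase transition -/

lemma measurable_pathLoss (C_L C_N α_L α_N R_c : ℝ) :
    Measurable (pathLoss C_L C_N α_L α_N R_c) :=
  Measurable.ite measurableSet_Iio ((measurable_id.pow_const _).const_mul _)
    ((measurable_id.pow_const _).const_mul _)

lemma pathLoss_pos {C_L C_N : ℝ} (hC_L : 0 < C_L) (hC_N : 0 < C_N) (α_L α_N R_c : ℝ) {r : ℝ}
    (hr : 0 < r) : 0 < pathLoss C_L C_N α_L α_N R_c r := by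
  unfold pathLoss
  split_ifs <;> positivity

end CellSearch

theorem mainTheorem3 {Ω : Type*} [MeasurableSpace Ω] (μ : Measure Ω) [IsProbabilityMeasure μ]
    (M : ℕ) (hM : 1 ≤ M)
    (lam P W Γ C_L C_N α_L α_N R_c : ℝ)
    (hlam : 0 < lam) (hP : 0 < P) (hW : 0 < W) (hΓ : 0 < Γ)
    (hC_L : 0 < C_L) (hC_N : 0 < C_N) (hR_c : 0 < R_c) (hα_N : α_N = 2)
    (hmono : MonotoneOn (CellSearch.pathLoss C_L C_N α_L α_N R_c) (Set.Ici 0))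
    (X : ℕ → Ω → CellSearch.Plane) (F : ℕ → ℕ → Ω → ℝ)
    (hnet : CellSearch.IsRayleighPoissonNetwork X F lam μ) :
    (lam * M < Γ * C_N * W / (P * Real.pi) →
      CellSearch.expectedNumCycles (CellSearch.pathLoss C_L C_N α_L α_N R_c)
        M P W Γ X F μ = ∞) ∧
    (Γ * C_N * W / (P * Real.pi) < lam * M →
      CellSearch.expectedNumCycles (CellSearch.pathLoss C_L C_N α_L α_N R_c)
        M P W Γ X F μ < ∞) := by
  have hM' : (0 : ℝ) < M := by exact_mod_cast hM
  have hpi := Real.pi_pos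
  have hR : ∀ r, R_c ≤ r → CellSearch.fadingThreshold M P W Γ
      (CellSearch.pathLoss C_L C_N α_L α_N R_c r) = Γ * (W / (P * M)) * C_N * r ^ 2 := by
    intro r hr
    rw [CellSearch.fadingThreshold, CellSearch.pathLoss, if_neg hr.not_gt, hα_N, Real.rpow_two]
    ring
  have hmeas := CellSearch.measurable_pathLoss C_L C_N α_L α_N R_c
  have hpos := fun r => CellSearch.pathLoss_pos hC_L hC_N α_L α_N R_c (r := r)
  -- Multiplying by `π / M` turns the comparison with `λ M` into the comparison of `a` with `λ π`.
  have hthr : Γ * (W / (P * M)) * C_N = Γ * C_N * W / (P * Real.pi) * (Real.pi / M) := by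
    field_simp
  have hlam' : lam * Real.pi = lam * M * (Real.pi / M) := by field_simp
  refine ⟨fun hlt => ?_, fun hlt => ?_⟩
  · refine hnet.expectedNumCycles_eq_top hM hlam.le hP hW hΓ hmeas hmono hpos hR ?_
    rw [hthr, hlam']
    gcongr
  · refine hnet.expectedNumCycles_lt_top hM hlam.le hP hW hΓ hmeas hmono hpos hR ?_
    rw [hthr, hlam']
    gcongr
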